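/- Let $n\ge 4$. For $\alpha=(\alpha_3,\dots,\alpha_n,\theta)\in\mathbb C^{n-1}$ let $L(\alpha)$ be the complex Leibniz algebra (with identity $[x,[y,z]]=[[x,y],z]-[[x,z],y]$) of dimension $n+1$ with basis $e_0,\dots,e_n$ and products $$[e_0,e_0]=e_2,\qquad [e_i,e_0]=e_{i+1}\ (1\le i\le n-1),\qquad [e_0,e_1]=\alpha_3e_3+\dots+\alpha_{n-1}e_{n-1}+\theta e_n,$$ $$[e_j,e_1]=\alpha_3e_{j+2}+\alpha_4e_{j+3}+\dots+\alpha_{n+1-j}e_n\ (1\le j\le n-2),$$ all other products of basis vectors being zero (these are the first-class non-Lie filiform Leibniz algebras). Let $U$ be the set of the $L(\alpha)$ with $\alpha_3(\alpha_4+2\alpha_3^2)\neq0$. For $y\in\mathbb C$ and $z=(z_3,\dots,z_n,z_{n+1})$, where $z_{n+1}$ stands for $\theta$ when $z=\alpha$, and for $3\le k<t\le n$ put $$S_{k,t}(y;z)=\sum_{m=1}^{k-1}\binom{k-1}{k-1-m}y^m\,N_m(k,t),\qquad N_1(k,t)=z_{t+2-k},$$ and, for $m\ge2$, $$N_m(k,t)=\sum_{i_{m-1}=k+m}^{t}\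 \sum_{i_{m-2}=k+m}^{i_{m-1}}\cdots\sum_{i_1=k+m}^{i_2} z_{t+3-i_{m-1}}\,z_{i_{m-1}+3-i_{m-2}}\cdots z_{i_2+3-i_1}\,z_{i_1+3-k-m}.$$ Define recursively $$\varphi_t(y;z)=(1+y)z_t-\sum_{k=3}^{t-1}S_{k,t}(y;z)\,\varphi_k(y;z)\quad(3\le t\le n),$$ $$\varphi_{n+1}(y;z)=z_{n+1}+y\,z_n-\sum_{k=3}^{n-1}S_{k,n}(y;z)\,\varphi_k(y;z),$$ and $\rho_i(x,y;z)=x^i\varphi_{i+2}(y;z)$ for $1\le i\le n-2$, $\rho_{n-1}(x,y;z)=x^{n-2}\varphi_{n+1}(y;z)$. (i) Two algebras $L(\alpha)$ and $L(\alpha')$ in $U$ are isomorphic if and only if $$\rho_i\Big(\frac{2\alpha_3}{\alpha_4+2\alpha_3^2},\frac{\alpha_4}{2\alpha_3^2};\alpha\Big)=\rho_i\Big(\frac{2\alpha_3'}{\alpha_4'+2\alpha_3'^2},\frac{\alpha_4'}{2\alpha_3'^2};\alpha'\Big)\qquad\text{for all } i=3,\dots,n-1.$$ (ii) For every $(a_3,\dots,a_{n-1})\in\mathbb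 C^{n-3}$ there is an algebra $L(\alpha)$ in $U$ such that $$\rho_i\Big(\frac{2\alpha_3}{\alpha_4+2\alpha_3^2},\frac{\alpha_4}{2\alpha_3^2};\alpha\Big)=a_i\qquad\text{for all } i=3,\dots,n-1.$$ -/

import Mathlib

namespace FiliformLeibniz

open Finset

/-- A Leibniz algebra structure on the `K`-module `V`: a bilinear bracket satisfying
`[x, [y, z]] = [[x, y], z] - [[x, z], y]`. -/
structure LeibnizAlgebra (K V : Type*) [CommRing K] [AddCommGroup V] [Module K V] where
  /-- The bracket, as a bilinear map. -/
  bracket : V →ₗ[K] V →ₗ[K] V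
  /-- The Leibniz identity. -/
  leibniz : ∀ x y z : V,
    bracket x (bracket y z) = bracket (bracket x y) z - bracket (bracket x z) y

/-- Isomorphism of Leibniz algebras: a linear bijection that preserves the brackets. -/
def LeibnizAlgebra.Isomorphic {K V W : Type*} [CommRing K] [AddCommGroup V] [Module K V]
    [AddCommGroup W] [Module K W] (A : LeibnizAlgebra K V) (B : LeibnizAlgebra K W) : Prop :=
  ∃ f : V ≃ₗ[K] W, ∀ x y : V, f (A.bracket x y) = B.bracket (f x) (f y)

/-- Parameter tuples `z = (z₃, z₄, …, zₙ, zₙ₊₁)`. For the tuple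
`α = (α₃, …, αₙ, θ)` the entry with index `n + 1` is `θ`. -/
abbrev Params (n : ℕ) : Type := ↥(Finset.Icc 3 (n + 1)) → ℂ

/-- The entry `z_t` of a tuple, for `3 ≤ t ≤ n + 1` (and `0` for other `t`, which never occur
below). -/
def Params.coeff {n : ℕ} (z : Params n) (t : ℕ) : ℂ :=
  if h : t ∈ Finset.Icc 3 (n + 1) then z ⟨t, h⟩ else 0

/-- The last entry `θ = z_{n+1}`. -/
def Params.theta {n : ℕ} (z : Params n) : ℂ := z.coeff (n + 1)

/-- The basis vector `e_k` of `ℂ^{n+1}`, `0 ≤ k ≤ n` (and `0` for `k > n`). -/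
def e (n k : ℕ) : Fin (n + 1) → ℂ := fun i => if (i : ℕ) = k then 1 else 0

/-- The multiplication table of the first class: the value of `[e_i, e_j]`. -/
def table {n : ℕ} (α : Params n) (i j : ℕ) : Fin (n + 1) → ℂ :=
  if j = 0 then
    if i = 0 then e n 2
    else if i ≤ n - 1 then e n (i + 1)
    else 0
  else if j = 1 then
    if i = 0 then ∑ k ∈ Finset.Icc 3 (n - 1), α.coeff k • e n k + α.theta • e n n
    else if i ≤ n - 2 then ∑ k ∈ Finset.Icc 3 (n + 1 - i), α.coeff k • e n (i + k - 1)
    else 0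
  else 0

/-- The bilinear map on `ℂ^{n+1}` with `[e_i, e_j] = table α i j`. -/
noncomputable def tableBracket {n : ℕ} (α : Params n) :
    (Fin (n + 1) → ℂ) →ₗ[ℂ] (Fin (n + 1) → ℂ) →ₗ[ℂ] (Fin (n + 1) → ℂ) :=
  (Pi.basisFun ℂ (Fin (n + 1))).constr ℂ fun i =>
    (Pi.basisFun ℂ (Fin (n + 1))).constr ℂ fun j => table α i j

theorem e_eq_basis {n : ℕ} (i : Fin (n + 1)) : e n i = Pi.basisFun ℂ (Fin (n + 1)) i := by
  ext j
  simp [e, Pi.single_apply, Fin.ext_iff]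

theorem e_eq_zero {n k : ℕ} (h : n < k) : e n k = 0 := by
  ext j
  have := j.isLt
  simp only [e, Pi.zero_apply, ite_eq_right_iff, one_ne_zero, imp_false]
  omega

theorem tableBracket_e {n : ℕ} (α : Params n) {i j : ℕ} (hi : i ≤ n) (hj : j ≤ n) :
    tableBracket α (e n i) (e n j) = table α i j := by
  have h1 := e_eq_basis (n := n) ⟨i, by omega⟩
  have h2 := e_eq_basis (n := n) ⟨j, by omega⟩
  simp only at h1 h2
  rw [h1, h2, tableBracket, Module.Basis.constr_basis, Module.Basis.constr_basis]

theorem bracket_e0 {n : ℕ} (α : Params n) {i : ℕ} (hi : 1 ≤ i) :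
    tableBracket α (e n i) (e n 0) = e n (i + 1) := by
  by_cases h : i ≤ n
  · rw [tableBracket_e α h (by omega), table, if_pos rfl, if_neg (by omega)]
    split_ifs
    · rfl
    · rw [e_eq_zero (by omega)]
  · rw [e_eq_zero (k := i) (by omega), e_eq_zero (k := i + 1) (by omega)]
    simp

theorem bracket_e1 {n : ℕ} (α : Params n) {i : ℕ} (hn : 1 ≤ n) (hi : 1 ≤ i) :
    tableBracket α (e n i) (e n 1) =
      ∑ k ∈ Finset.Icc 3 (n + 1 - i), α.coeff k • e n (i + k - 1) := by
  by_cases h : i ≤ n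
  · rw [tableBracket_e α h (by omega), table, if_neg (by omega), if_pos rfl, if_neg (by omega)]
    split_ifs
    · rfl
    · rw [Finset.Icc_eq_empty (by omega), Finset.sum_empty]
  · rw [e_eq_zero (k := i) (by omega), Finset.Icc_eq_empty (by omega)]
    simp

theorem bracket_e_ge_two {n : ℕ} (α : Params n) {j : ℕ} (hj : 2 ≤ j) (x : Fin (n + 1) → ℂ) :
    tableBracket α x (e n j) = 0 := by
  by_cases h : j ≤ n
  · have : (tableBracket α).flip (e n j) = 0 := by
      refine (Pi.basisFun ℂ (Fin (n + 1))).ext fun i => ?_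
      rw [← e_eq_basis, LinearMap.flip_apply, tableBracket_e α (by omega) h, table,
        if_neg (by omega), if_neg (by omega)]
      simp
    exact congrArg (fun f => f x) this
  · rw [e_eq_zero (by omega)]
    simp

theorem theta_eq_zero {n : ℕ} (α : Params n) (hn : n < 2) : α.theta = 0 := by
  rw [Params.theta, Params.coeff, dif_neg]
  rw [Finset.mem_Icc]
  omega

theorem bracket_table {n : ℕ} (α : Params n) (x : Fin (n + 1) → ℂ) (i j : ℕ) :
    tableBracket α x (table α i j) = 0 := by
  have hs : ∀ (s : Finset ℕ) (c : ℕ → ℂ) (d : ℕ → ℕ), (∀ k ∈ s, 2 ≤ d k) →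
      tableBracket α x (∑ k ∈ s, c k • e n (d k)) = 0 := by
    intro s c d h
    rw [map_sum]
    refine Finset.sum_eq_zero fun k hk => ?_
    rw [map_smul, bracket_e_ge_two α (h k hk), smul_zero]
  unfold table
  split_ifs
  · exact bracket_e_ge_two α le_rfl x
  · exact bracket_e_ge_two α (by omega) x
  · simp
  · rw [map_add, hs _ _ _ fun k hk => by rw [Finset.mem_Icc] at hk; omega, zero_add]
    by_cases hn : n < 2
    · rw [theta_eq_zero α hn]
      simp
    · rw [map_smul, bracket_e_ge_two α (by omega), smul_zero]
  · exact hs _ _ _ fun k hk => by rw [Finset.mem_Icc] at hk; omega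
  · simp
  · simp

theorem e_induction {n : ℕ} {P : (Fin (n + 1) → ℂ) → Prop} (x : Fin (n + 1) → ℂ)
    (h0 : P 0) (ha : ∀ x y, P x → P y → P (x + y)) (hc : ∀ (c : ℂ) x, P x → P (c • x))
    (he : ∀ i, i ≤ n → P (e n i)) : P x := by
  rw [← (Pi.basisFun ℂ (Fin (n + 1))).sum_repr x]
  refine Finset.sum_induction _ P ha h0 fun i _ => hc _ _ ?_
  rw [← e_eq_basis]
  exact he _ (by omega)

theorem bracket_bracket {n : ℕ} (α : Params n) (x y z : Fin (n + 1) → ℂ) :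
    tableBracket α x (tableBracket α y z) = 0 := by
  induction y using e_induction with
  | h0 => simp
  | ha y y' h h' => simp [h, h']
  | hc c y h => simp [h]
  | he i hi =>
    induction z using e_induction with
    | h0 => simp
    | ha y y' h h' => simp [h, h']
    | hc c y h => simp [h]
    | he j hj => rw [tableBracket_e α hi hj, bracket_table]

theorem bracket_e0_e1 {n : ℕ} (α : Params n) (i : ℕ) :
    tableBracket α (tableBracket α (e n i) (e n 0)) (e n 1) =
      tableBracket α (tableBracket α (e n i) (e n 1)) (e n 0) := by
  rcases Nat.eq_zero_or_pos n with rfl | hn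
  · rw [e_eq_zero (n := 0) (k := 1) one_pos]
    simp
  rcases Nat.eq_zero_or_pos i with rfl | hi
  · have t0 : table α 0 0 = e n 2 := by simp [table]
    have t1 : table α 0 1 = ∑ k ∈ Finset.Icc 3 (n - 1), α.coeff k • e n k + α.theta • e n n := by
      simp [table]
    rw [tableBracket_e α (by omega) (by omega), tableBracket_e α (by omega) hn, t0, t1,
      bracket_e1 α hn (by omega), map_add, LinearMap.add_apply, map_smul, LinearMap.smul_apply,
      bracket_e0 α hn, e_eq_zero (Nat.lt_succ_self n), smul_zero, add_zero, map_sum,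
      LinearMap.sum_apply]
    refine Finset.sum_congr (by congr 1) fun k hk => ?_
    rw [Finset.mem_Icc] at hk
    rw [map_smul, LinearMap.smul_apply, bracket_e0 α (by omega)]
    congr 2
    omega
  · rw [bracket_e0 α hi, bracket_e1 α hn hi, bracket_e1 α hn (by omega), map_sum,
      LinearMap.sum_apply]
    have hsub : Finset.Icc 3 (n + 1 - (i + 1)) ⊆ Finset.Icc 3 (n + 1 - i) :=
      Finset.Icc_subset_Icc le_rfl (by omega)
    rw [Finset.sum_subset hsub]
    · refine Finset.sum_congr rfl fun k hk => ?_
      rw [Finset.mem_Icc] at hk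
      rw [map_smul, LinearMap.smul_apply, bracket_e0 α (by omega)]
      congr 2
      omega
    · intro k hk hk'
      rw [Finset.mem_Icc] at hk hk'
      rw [e_eq_zero (by omega), smul_zero]

theorem bracket_comm {n : ℕ} (α : Params n) (x y z : Fin (n + 1) → ℂ) :
    tableBracket α (tableBracket α x y) z = tableBracket α (tableBracket α x z) y := by
  induction x using e_induction with
  | h0 => simp
  | ha y y' h h' => simp [h, h']
  | hc c y h => simp [h]
  | he i hi =>
    induction y using e_induction with
    | h0 => simp
    | ha y y' h h' => simp [h, h']
    | hc c y h => simp [h]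
    | he j hj =>
      induction z using e_induction with
      | h0 => simp
      | ha y y' h h' => simp [h, h']
      | hc c y h => simp [h]
      | he k hk =>
        by_cases h2 : 2 ≤ j
        · rw [bracket_e_ge_two α h2, bracket_e_ge_two α h2, map_zero, LinearMap.zero_apply]
        by_cases h3 : 2 ≤ k
        · rw [bracket_e_ge_two α h3, bracket_e_ge_two α h3, map_zero, LinearMap.zero_apply]
        have hj' : j = 0 ∨ j = 1 := by omega
        have hk' : k = 0 ∨ k = 1 := by omega
        rcases hj' with rfl | rfl <;> rcases hk' with rfl | rfl
        · rfl
        · exact bracket_e0_e1 α i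
        · exact (bracket_e0_e1 α i).symm
        · rfl

/-- The `(n+1)`-dimensional Leibniz algebra `L(α)` of the first class, on `ℂ^{n+1}`. -/
noncomputable def L {n : ℕ} (α : Params n) : LeibnizAlgebra ℂ (Fin (n + 1) → ℂ) where
  bracket := tableBracket α
  leibniz x y z := by rw [bracket_comm α x y z, sub_self, bracket_bracket]

/-- The open set `U`: those `α` with `α₃ (α₄ + 2 α₃²) ≠ 0`. -/
def genericSet (n : ℕ) : Set (Params n) :=
  {α | α.coeff 3 * (α.coeff 4 + 2 * α.coeff 3 ^ 2) ≠ 0}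

/-- The iterated sums in the transformation formulas. With lower bound `b`,
`nested z b r s = ∑_{i_r = b}^{s} ∑_{i_{r-1} = b}^{i_r} ⋯ ∑_{i_1 = b}^{i_2}`
`z_{s + 3 - i_r} z_{i_r + 3 - i_{r-1}} ⋯ z_{i_2 + 3 - i_1} z_{i_1 + 3 - b}`,
and `nested z b 0 s = z_{s + 3 - b}`. -/
noncomputable def nested {n : ℕ} (z : Params n) (b : ℕ) : ℕ → ℕ → ℂ
  | 0, s => z.coeff (s + 3 - b)
  | r + 1, s => ∑ i ∈ Finset.Icc b s, z.coeff (s + 3 - i) * nested z b r i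

/-- The factor of `φ_k` in the transformation formulas, the sum over `m = 1, …, k - 1` of
`C_{k-1}^{k-1-m} y^m` times the iterated sum with `m` factors and lower bound `k + m`. -/
noncomputable def factor {n : ℕ} (y : ℂ) (z : Params n) (k t : ℕ) : ℂ :=
  ∑ m ∈ Finset.Icc 1 (k - 1),
    ((k - 1).choose (k - 1 - m) : ℂ) * y ^ m * nested z (k + m) (m - 1) t

/-- The functions `φ_t(y; z)`, `3 ≤ t ≤ n`:
`φ_t = (1 + y) z_t - ∑_{k=3}^{t-1} factor(k, t) φ_k`. -/
noncomputable def phi {n : ℕ} (y : ℂ) (z : Params n) (t : ℕ) : ℂ :=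
  (1 + y) * z.coeff t - ∑ k ∈ (Finset.Icc 3 (t - 1)).attach, factor y z k t * phi y z k
termination_by t
decreasing_by
  have := Finset.mem_Icc.mp k.2
  omega

/-- The function `φ_{n+1}(y; z) = z_{n+1} + y z_n - ∑_{k=3}^{n-1} factor(k, n) φ_k`. -/
noncomputable def phiLast {n : ℕ} (y : ℂ) (z : Params n) : ℂ :=
  z.theta + y * z.coeff n - ∑ k ∈ Finset.Icc 3 (n - 1), factor y z k n * phi y z k

/-- The components of `ρ(x, y; z)`: `ρ_i = x^i φ_{i+2}(y; z)` for `1 ≤ i ≤ n - 2` and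
`ρ_{n-1} = x^{n-2} φ_{n+1}(y; z)`. -/
noncomputable def rho {n : ℕ} (x y : ℂ) (z : Params n) (i : ℕ) : ℂ :=
  if i = n - 1 then x ^ (n - 2) * phiLast y z else x ^ i * phi y z (i + 2)

end FiliformLeibniz

/-! Identify `e_{k+1}` with `X^k`, so that the span of `e_1, …, e_n` becomes `ℂ[X]/(X^n)`. There
right multiplication by `e_0` is multiplication by `X`, right multiplication by `e_1` is
multiplication by `P = ∑ α_{k+1} X^k` (`gen α`), and `e_2, …, e_n` act by zero from the right. The
complementary vector `e_0 - e_1` is killed by `e_0` and sent by `e_1` to `δ X^{n-1}`, where `δ = θ -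
α_n`. Thus `P` modulo `X^n` and `δ` encode the algebra (`bracket_elt`).

An isomorphism `L(α') → L(α)` carries `X` to `u = aX + bP`, and the brackets of `e_0` and `e_1`
translate into `P'(u) ≡ (a + b) P` modulo `X^n` together with `a^{n-2} δ' = δ`; conversely, these
relations with `a(a + b) ≠ 0` produce an isomorphism (`isomorphic_iff`). The iterated sums are
coefficients of powers of `X + yP`, so comparing coefficients gives `α'_{i+2} = ρ_i(1/a, b/a; α)`
(`rho_iff`).

On `U` the values of `x` and `y` in the theorem are those that make `α'_3 = 1` and `α'_4 = 0`.
Between two parameters so normalised only `x = 1`, `y = 0` is possible, and this is the identity.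
The other entries of the normal form are therefore complete invariants, and they are arbitrary
because a normalised parameter is its own normal form. -/

namespace FiliformLeibniz

open Finset PowerSeries

/-! ### Generating series and the functions `φ` and `ρ` -/

/-- The power series `∑ z_{k+1} X^k`. -/
noncomputable def gen {n : ℕ} (z : Params n) : ℂ⟦X⟧ := PowerSeries.mk fun k => z.coeff (k + 1)

/-- The power series `∑ z_{k+3} X^k`. -/
noncomputable def genShift {n : ℕ} (z : Params n) : ℂ⟦X⟧ :=
  PowerSeries.mk fun k => z.coeff (k + 3)

theorem coeff_of_lt_three {n : ℕ} (z : Params n) {t : ℕ} (ht : t < 3) : z.coeff t = 0 := by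
  rw [Params.coeff, dif_neg]
  rw [Finset.mem_Icc]
  omega

theorem gen_eq {n : ℕ} (z : Params n) : gen z = X ^ 2 * genShift z := by
  ext k
  rw [coeff_X_pow_mul', gen, coeff_mk, genShift, coeff_mk]
  split_ifs with h
  · congr 1
    omega
  · exact coeff_of_lt_three z (by omega)

/-- After the shift `i ↦ i - b` each summation is a Cauchy product with `genShift z`. -/
theorem nested_eq {n : ℕ} (z : Params n) (b r s : ℕ) :
    nested z b r s = if b ≤ s then coeff (s - b) (genShift z ^ (r + 1)) else 0 := by
  induction r generalizing s with
  | zero =>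
    rw [nested, zero_add, pow_one, genShift, coeff_mk]
    split_ifs with h
    · congr 1
      omega
    · exact coeff_of_lt_three z (by omega)
  | succ r ih =>
    rw [nested]
    split_ifs with h
    · rw [pow_succ', coeff_mul, Finset.Nat.sum_antidiagonal_eq_sum_range_succ_mk,
        ← Finset.sum_range_reflect]
      refine Finset.sum_bij' (fun i _ => i - b) (fun i _ => i + b) ?_ ?_ ?_ ?_ ?_
      · intro i hi
        simp only [Finset.mem_Icc, Finset.mem_range] at *
        omega
      · intro i hi
        simp only [Finset.mem_Icc, Finset.mem_range] at *
        omega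
      · intro i hi
        simp only [Finset.mem_Icc] at *
        omega
      · intro i hi
        simp
      · intro i hi
        simp only [Finset.mem_Icc] at hi
        rw [ih, if_pos hi.1, genShift, coeff_mk]
        congr 2
        · omega
        · congr 1
          omega
    · rw [Finset.Icc_eq_empty (by omega), Finset.sum_empty]

/-- With `gen z = X^2 Q`, the `m`-th binomial term is `C(k-1, m) y^m X^{k-1+m} Q^m`, which explains
the lower bound `k + m` of the iterated sums. The term `m = 0` is `X^{k-1}` and does not contribute
because `k < t`. -/
theorem coeff_pow_eq_factor {n : ℕ} (y : ℂ) (z : Params n) {k t : ℕ} (hk : 1 ≤ k) (hkt : k < t) :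
    coeff (t - 1) ((X + C y * gen z) ^ (k - 1)) = factor y z k t := by
  rw [add_comm, add_pow, map_sum, factor, Finset.sum_range_succ']
  have h0 : coeff (t - 1)
      ((C y * gen z) ^ 0 * X ^ (k - 1 - 0) * (((k - 1).choose 0 : ℕ) : ℂ⟦X⟧)) = 0 := by
    rw [pow_zero, one_mul, Nat.choose_zero_right, Nat.cast_one, mul_one, coeff_X_pow,
      if_neg (by omega)]
  rw [h0, add_zero]
  refine Finset.sum_bij' (fun m _ => m + 1) (fun m _ => m - 1) ?_ ?_ ?_ ?_ ?_
  · intro m hm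
    simp only [Finset.mem_Icc, Finset.mem_range] at *
    omega
  · intro m hm
    simp only [Finset.mem_Icc, Finset.mem_range] at *
    omega
  · simp
  · intro m hm
    simp only [Finset.mem_Icc] at *
    omega
  · intro m hm
    simp only [Finset.mem_range] at hm
    have h1 : (C y * gen z) ^ (m + 1) * X ^ (k - 1 - (m + 1)) *
        (((k - 1).choose (m + 1) : ℕ) : ℂ⟦X⟧) =
        C (((k - 1).choose (m + 1) : ℂ) * y ^ (m + 1)) *
          (X ^ (k + m) * genShift z ^ (m + 1)) := by
      have h2 : k + m = 2 * (m + 1) + (k - 1 - (m + 1)) := by omega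
      rw [gen_eq, h2, pow_add X, map_mul, map_natCast, map_pow, pow_mul X]
      ring
    rw [h1, coeff_C_mul, coeff_X_pow_mul', nested_eq, Nat.choose_symm (by omega),
      Nat.add_sub_cancel]
    congr 1
    by_cases h : k + m ≤ t - 1
    · rw [if_pos h, if_pos (by omega)]
      congr 2
      omega
    · rw [if_neg h, if_neg (by omega)]

theorem phi_eq {n : ℕ} (y : ℂ) (z : Params n) (t : ℕ) :
    phi y z t = (1 + y) * z.coeff t - ∑ k ∈ Finset.Icc 3 (t - 1), factor y z k t * phi y z k := by
  rw [phi, Finset.sum_attach (Finset.Icc 3 (t - 1)) (fun k => factor y z k t * phi y z k)]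

/-- The recursion is triangular. It is used below with `f t = a^{t-2} z'_t`. -/
theorem phi_unique {n : ℕ} (y : ℂ) (z : Params n) (f : ℕ → ℂ) (N : ℕ) :
    (∀ t ∈ Finset.Icc 3 N,
      f t + ∑ k ∈ Finset.Icc 3 (t - 1), factor y z k t * f k = (1 + y) * z.coeff t) ↔
    ∀ t ∈ Finset.Icc 3 N, f t = phi y z t := by
  constructor
  · intro h t
    induction t using Nat.strong_induction_on with
    | _ t ih =>
      intro ht
      rw [phi_eq, ← h t ht, eq_sub_iff_add_eq]
      congr 1
      refine Finset.sum_congr rfl fun k hk => ?_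
      rw [Finset.mem_Icc] at hk ht
      rw [ih k (by omega) (Finset.mem_Icc.2 (by omega))]
  · intro h t ht
    rw [h t ht, phi_eq, ← eq_sub_iff_add_eq]
    congr 1
    refine Finset.sum_congr rfl fun k hk => ?_
    rw [Finset.mem_Icc] at hk ht
    rw [h k (Finset.mem_Icc.2 (by omega))]

/-- The recursions for `φ_n` and `φ_{n+1}` subtract the same sum; this is why `θ` enters only
through `θ - z_n`. -/
theorem phiLast_eq {n : ℕ} (y : ℂ) (z : Params n) :
    phiLast y z = phi y z n + (z.theta - z.coeff n) := by
  rw [phi_eq, phiLast]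
  ring

theorem hasSubst_of_X_dvd {u : ℂ⟦X⟧} (hu : X ∣ u) : HasSubst u :=
  HasSubst.of_constantCoeff_zero' (X_dvd_iff.1 hu)

theorem coeff_subst_eq_sum {u : ℂ⟦X⟧} (hu : X ∣ u) (p : ℂ⟦X⟧) (j : ℕ) :
    coeff j (p.subst u) = ∑ k ∈ Finset.range (j + 1), coeff k p * coeff j (u ^ k) := by
  rw [coeff_subst' (hasSubst_of_X_dvd hu)]
  simp only [smul_eq_mul]
  refine finsum_eq_sum_of_support_subset _ fun k hk => ?_
  by_contra h
  simp only [Finset.coe_range, Set.mem_Iio, not_lt] at h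
  refine hk ?_
  have := X_pow_dvd_iff.1 (pow_dvd_pow_of_dvd hu k) j (by omega)
  simp [this]

theorem X_dvd_gen {n : ℕ} (z : Params n) : X ∣ gen z := by
  rw [gen_eq, pow_two, mul_assoc]
  exact dvd_mul_right _ _

theorem X_dvd_linear {n : ℕ} (z : Params n) (a b : ℂ) : X ∣ C a * X + C b * gen z :=
  dvd_add (dvd_mul_left _ _) ((X_dvd_gen z).mul_left _)

/-- Since `aX + bP = a(X + (b/a)P)`, the coefficient of `X^{t-1}` on the left is a sum of `z'_k
a^{k-1}` times the factors of the recursion, with `z'_t a^{t-1}` as top term. Division by `a` gives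
the recursion of `φ`. -/
theorem subst_gen_iff {n : ℕ} (z z' : Params n) {a b : ℂ} (ha : a ≠ 0) :
    (∀ j < n, coeff j ((gen z').subst (C a * X + C b * gen z)) = (a + b) * coeff j (gen z)) ↔
    ∀ t ∈ Finset.Icc 3 n, a ^ (t - 2) * z'.coeff t = phi (b / a) z t := by
  rw [← phi_unique]
  have hu : C a * X + C b * gen z = C a * (X + C (b / a) * gen z) := by
    rw [mul_add, ← mul_assoc, ← map_mul, mul_div_cancel₀ _ ha]
  have key : ∀ t, 3 ≤ t → coeff (t - 1) ((gen z').subst (C a * X + C b * gen z)) =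
      a * (a ^ (t - 2) * z'.coeff t +
        ∑ k ∈ Finset.Icc 3 (t - 1), factor (b / a) z k t * (a ^ (k - 2) * z'.coeff k)) := by
    intro t ht
    rw [coeff_subst_eq_sum (X_dvd_linear z a b), Finset.sum_range_succ, add_comm, mul_add,
      Finset.mul_sum]
    have hpow : ∀ k, (C a * X + C b * gen z) ^ k = C (a ^ k) * (X + C (b / a) * gen z) ^ k := by
      intro k
      rw [hu, mul_pow, map_pow]
    congr 1
    · rw [hpow, coeff_C_mul]
      have h1 : coeff (t - 1) ((X + C (b / a) * gen z) ^ (t - 1)) = 1 := by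
        rw [gen_eq, show (X + C (b / a) * (X ^ 2 * genShift z) : ℂ⟦X⟧) =
          X * (1 + X * (C (b / a) * genShift z)) by ring, mul_pow]
        rw [coeff_X_pow_mul', if_pos le_rfl, Nat.sub_self]
        simp
      rw [h1, gen, coeff_mk, show t - 1 + 1 = t by omega, show t - 1 = t - 2 + 1 by omega, pow_succ]
      ring
    · have hsub : Finset.Ico 2 (t - 1) ⊆ Finset.range (t - 1) := fun k hk => by
        rw [Finset.mem_Ico] at hk
        exact Finset.mem_range.2 hk.2
      rw [← Finset.sum_subset hsub]
      · refine Finset.sum_bij' (fun k _ => k + 1) (fun k _ => k - 1) ?_ ?_ ?_ ?_ ?_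
        · intro k hk
          simp only [Finset.mem_Icc, Finset.mem_Ico] at *
          omega
        · intro k hk
          simp only [Finset.mem_Icc, Finset.mem_Ico] at *
          omega
        · simp
        · intro k hk
          simp only [Finset.mem_Icc] at *
          omega
        · intro k hk
          rw [Finset.mem_Ico] at hk
          rw [hpow, coeff_C_mul, ← coeff_pow_eq_factor _ _ (by omega) (by omega),
            Nat.add_sub_cancel, gen, coeff_mk, show k + 1 - 2 = k - 1 by omega]
          have hak : a ^ k = a * a ^ (k - 1) := by
            rw [← pow_succ', Nat.sub_add_cancel (by omega)]
          rw [hak]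
          ring
      · intro k hk hk'
        rw [Finset.mem_range] at hk
        rw [Finset.mem_Ico] at hk'
        rw [gen, coeff_mk, coeff_of_lt_three z' (by omega), zero_mul]
  constructor
  · intro h t ht
    rw [Finset.mem_Icc] at ht
    have h1 := h (t - 1) (by omega)
    rw [key t ht.1, gen, coeff_mk, show t - 1 + 1 = t by omega] at h1
    apply mul_left_cancel₀ ha
    rw [h1]
    field_simp
  · intro h j hj
    by_cases h3 : 2 ≤ j
    · have h1 := h (j + 1) (Finset.mem_Icc.2 (by omega))
      have h2 := key (j + 1) (by omega)
      rw [h1, Nat.add_sub_cancel] at h2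
      rw [h2, gen, coeff_mk]
      field_simp
    · have h4 : coeff j (gen z) = 0 := by
        rw [gen, coeff_mk, coeff_of_lt_three z (by omega)]
      rw [h4, mul_zero, coeff_subst_eq_sum (X_dvd_linear z a b)]
      refine Finset.sum_eq_zero fun k hk => ?_
      rw [Finset.mem_range] at hk
      rw [gen, coeff_mk, coeff_of_lt_three z' (by omega), zero_mul]

theorem rho_iff {n : ℕ} (hn : 4 ≤ n) (z z' : Params n) {a b : ℂ} (ha : a ≠ 0) :
    ((∀ j < n, coeff j ((gen z').subst (C a * X + C b * gen z)) = (a + b) * coeff j (gen z)) ∧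
      a ^ (n - 2) * (z'.theta - z'.coeff n) = z.theta - z.coeff n) ↔
    ∀ i ∈ Finset.Icc 1 (n - 1), rho a⁻¹ (b / a) z i = z'.coeff (i + 2) := by
  rw [subst_gen_iff z z' ha]
  constructor
  · rintro ⟨h, h'⟩ i hi
    rw [Finset.mem_Icc] at hi
    rw [rho, inv_pow, inv_pow]
    split_ifs with hin
    · rw [phiLast_eq, ← h n (Finset.mem_Icc.2 (by omega)), ← h', hin,
        show n - 1 + 2 = n + 1 by omega, ← Params.theta]
      field_simp
      ring
    · rw [← h (i + 2) (Finset.mem_Icc.2 (by omega)), Nat.add_sub_cancel]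
      field_simp
  · intro h
    have h1 : ∀ t ∈ Finset.Icc 3 n, a ^ (t - 2) * z'.coeff t = phi (b / a) z t := by
      intro t ht
      rw [Finset.mem_Icc] at ht
      have := h (t - 2) (Finset.mem_Icc.2 (by omega))
      rw [rho, inv_pow, inv_pow, if_neg (by omega), show t - 2 + 2 = t by omega] at this
      rw [← this]
      field_simp
    refine ⟨h1, ?_⟩
    have h2 := h (n - 1) (Finset.mem_Icc.2 (by omega))
    rw [rho, inv_pow, inv_pow, if_pos rfl, phiLast_eq, ← h1 n (Finset.mem_Icc.2 (by omega)),
        show n - 1 + 2 = n + 1 by omega, ← Params.theta] at h2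
    rw [← h2]
    field_simp
    ring

/-! ### The bracket on truncated power series -/

/-- The linear map `p ↦ ∑ p_k e_{k+1}`. -/
noncomputable def ofSeries (n : ℕ) : ℂ⟦X⟧ →ₗ[ℂ] (Fin (n + 1) → ℂ) where
  toFun p i := if (i : ℕ) = 0 then 0 else coeff ((i : ℕ) - 1) p
  map_add' p q := by
    ext i
    simp only [Pi.add_apply, map_add]
    split_ifs <;> simp
  map_smul' c p := by
    ext i
    simp

/-- The power series `∑ v_{k+1} X^k`. -/
noncomputable def toSeries (n : ℕ) : (Fin (n + 1) → ℂ) →ₗ[ℂ] ℂ⟦X⟧ where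
  toFun v := PowerSeries.mk fun k => if h : k < n then v ⟨k + 1, by omega⟩ else 0
  map_add' v w := by
    ext k
    simp only [coeff_mk, map_add]
    split_ifs <;> simp
  map_smul' c v := by
    ext k
    simp

theorem ofSeries_X_pow (n k : ℕ) : ofSeries n (X ^ k) = e n (k + 1) := by
  ext i
  simp only [ofSeries, LinearMap.coe_mk, AddHom.coe_mk, coeff_X_pow, e]
  split_ifs <;> first | rfl | omega

theorem ofSeries_one (n : ℕ) : ofSeries n 1 = e n 1 := by
  simpa using ofSeries_X_pow n 0

theorem ofSeries_eq_ofSeries_iff {n : ℕ} {p q : ℂ⟦X⟧} :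
    ofSeries n p = ofSeries n q ↔ ∀ k < n, coeff k p = coeff k q := by
  constructor
  · intro h k hk
    have := congrFun h ⟨k + 1, by omega⟩
    simpa [ofSeries] using this
  · intro h
    ext i
    simp only [ofSeries, LinearMap.coe_mk, AddHom.coe_mk]
    split_ifs with h0
    · rfl
    · exact h _ (by omega)

theorem ofSeries_toSeries {n : ℕ} (v : Fin (n + 1) → ℂ) :
    v 0 • e n 0 + ofSeries n (toSeries n v) = v := by
  ext i
  by_cases h0 : i = 0
  · subst h0
    simp [e, ofSeries]
  · have h1 : (i : ℕ) ≠ 0 := fun h => h0 (Fin.ext h)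
    have h2 : (i : ℕ) - 1 < n := by omega
    have h3 : (⟨(i : ℕ) - 1 + 1, by omega⟩ : Fin (n + 1)) = i := Fin.ext (by simp; omega)
    simp [e, ofSeries, toSeries, h0, h1, h2, h3]

/-- The element `s (e_0 - e_1) + ∑ p_k e_{k+1}`. -/
noncomputable def elt (n : ℕ) (s : ℂ) (p : ℂ⟦X⟧) : Fin (n + 1) → ℂ :=
  s • (e n 0 - e n 1) + ofSeries n p

theorem exists_elt {n : ℕ} (v : Fin (n + 1) → ℂ) : ∃ s p, v = elt n s p := by
  -- The constant `v 0` compensates for the `-e_1` in `e_0 - e_1`.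
  refine ⟨v 0, toSeries n v + C (v 0), ?_⟩
  have h : ofSeries n (C (v 0)) = v 0 • e n 1 := by
    rw [← ofSeries_one, ← map_smul, smul_eq_C_mul, mul_one]
  rw [elt, map_add, h, smul_sub]
  nth_rw 1 [← ofSeries_toSeries v]
  abel

theorem elt_zero (n : ℕ) (p : ℂ⟦X⟧) : elt n 0 p = ofSeries n p := by
  simp [elt]

theorem elt_inj {n : ℕ} {s s' : ℂ} {p p' : ℂ⟦X⟧} :
    elt n s p = elt n s' p' ↔ s = s' ∧ ∀ k < n, coeff k p = coeff k p' := by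
  constructor
  · intro h
    have h0 : s = s' := by
      simpa [elt, e, ofSeries] using congrFun h 0
    subst h0
    exact ⟨rfl, ofSeries_eq_ofSeries_iff.1 (add_left_cancel h)⟩
  · rintro ⟨rfl, h⟩
    rw [elt, elt, ofSeries_eq_ofSeries_iff.2 h]

theorem eq_sum_add_X_pow_mul (n : ℕ) (p : ℂ⟦X⟧) :
    ∃ q, p = ∑ k ∈ Finset.range n, coeff k p • X ^ k + X ^ n * q := by
  refine ⟨PowerSeries.mk fun i => coeff (i + n) p, (eq_X_pow_mul_shift_add_trunc n p).trans ?_⟩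
  rw [add_comm]
  congr 1
  ext j
  simp [Polynomial.coeff_coe, coeff_trunc, coeff_X_pow]

/-- Two linear maps on power series that vanish on the multiples of `X ^ n` and agree on the
powers of `X` agree. -/
theorem linearMap_ext_of_X_pow {M : Type*} [AddCommGroup M] [Module ℂ M] (n : ℕ)
    {f g : ℂ⟦X⟧ →ₗ[ℂ] M} (hf : ∀ p, f (X ^ n * p) = 0) (hg : ∀ p, g (X ^ n * p) = 0)
    (h : ∀ k < n, f (X ^ k) = g (X ^ k)) (p : ℂ⟦X⟧) : f p = g p := by
  obtain ⟨q, hq⟩ := eq_sum_add_X_pow_mul n p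
  rw [hq, map_add, map_add, hf, hg, map_sum, map_sum]
  congr 1
  refine Finset.sum_congr rfl fun k hk => ?_
  rw [map_smul, map_smul, h k (Finset.mem_range.1 hk)]

theorem ofSeries_eq_of_dvd {n : ℕ} {p q : ℂ⟦X⟧} (h : X ^ n ∣ p - q) :
    ofSeries n p = ofSeries n q := by
  rw [ofSeries_eq_ofSeries_iff]
  intro k hk
  rw [← sub_eq_zero, ← map_sub]
  exact X_pow_dvd_iff.1 h k hk

theorem ofSeries_X_pow_mul (n : ℕ) (p : ℂ⟦X⟧) : ofSeries n (X ^ n * p) = 0 := by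
  rw [← map_zero (ofSeries n)]
  exact ofSeries_eq_of_dvd (by simp)

theorem ofSeries_eq_iff_dvd {n : ℕ} {p q : ℂ⟦X⟧} :
    ofSeries n p = ofSeries n q ↔ X ^ n ∣ p - q := by
  refine ⟨fun h => X_pow_dvd_iff.2 fun k hk => ?_, ofSeries_eq_of_dvd⟩
  rw [map_sub, ofSeries_eq_ofSeries_iff.1 h k hk, sub_self]

theorem ofSeries_C_mul (n : ℕ) (c : ℂ) (p : ℂ⟦X⟧) :
    ofSeries n (C c * p) = c • ofSeries n p := by
  rw [← smul_eq_C_mul, map_smul]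

theorem bracket_ofSeries_e0 {n : ℕ} (α : Params n) (p : ℂ⟦X⟧) :
    tableBracket α (ofSeries n p) (e n 0) = ofSeries n (p * X) := by
  refine linearMap_ext_of_X_pow n (f := (tableBracket α).flip (e n 0) ∘ₗ ofSeries n)
    (g := ofSeries n ∘ₗ LinearMap.mulRight ℂ X) ?_ ?_ ?_ p
  · intro p
    simp [ofSeries_X_pow_mul]
  · intro p
    simp [mul_assoc, ofSeries_X_pow_mul]
  · intro k _
    simp only [LinearMap.comp_apply, LinearMap.flip_apply, LinearMap.mulRight_apply, ← pow_succ,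
      ofSeries_X_pow]
    exact bracket_e0 α (by omega)

/-- The cut-off of the table at `α_{n+1-j}` is truncation modulo `X^n`; in particular the
coefficient `θ` of `X^n` in `gen α` has no effect. -/
theorem bracket_ofSeries_e1 {n : ℕ} (α : Params n) (p : ℂ⟦X⟧) :
    tableBracket α (ofSeries n p) (e n 1) = ofSeries n (p * gen α) := by
  refine linearMap_ext_of_X_pow n (f := (tableBracket α).flip (e n 1) ∘ₗ ofSeries n)
    (g := ofSeries n ∘ₗ LinearMap.mulRight ℂ (gen α)) ?_ ?_ ?_ p
  · intro p
    simp [ofSeries_X_pow_mul]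
  · intro p
    simp [mul_assoc, ofSeries_X_pow_mul]
  · intro k hk
    simp only [LinearMap.comp_apply, LinearMap.flip_apply, LinearMap.mulRight_apply,
      ofSeries_X_pow]
    rw [bracket_e1 α (by omega) (by omega)]
    have h : ∑ j ∈ Finset.Icc 3 (n + 1 - (k + 1)), α.coeff j • e n (k + 1 + j - 1) =
        ofSeries n (∑ j ∈ Finset.Icc 3 (n + 1 - (k + 1)), α.coeff j • X ^ (k + j - 1)) := by
      rw [map_sum]
      refine Finset.sum_congr rfl fun j hj => ?_
      rw [Finset.mem_Icc] at hj
      rw [map_smul, ofSeries_X_pow]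
      congr 2
      omega
    rw [h, ofSeries_eq_ofSeries_iff]
    intro i hi
    simp only [map_sum, coeff_smul, coeff_X_pow, coeff_X_pow_mul', gen, coeff_mk, smul_eq_mul, mul_ite,
      mul_one, mul_zero]
    by_cases h2 : k + 2 ≤ i
    · rw [Finset.sum_eq_single (i - k + 1), if_pos (by omega), if_pos (by omega)]
      · intro j hj hji
        rw [Finset.mem_Icc] at hj
        exact if_neg (by omega)
      · intro hj
        rw [Finset.mem_Icc] at hj
        omega
    · rw [Finset.sum_eq_zero]
      · split_ifs
        · rw [coeff_of_lt_three α (by omega)]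
        · rfl
      · intro j hj
        rw [Finset.mem_Icc] at hj
        exact if_neg (by omega)

theorem bracket_right_ofSeries {n : ℕ} (α : Params n) (v : Fin (n + 1) → ℂ) (p : ℂ⟦X⟧) :
    tableBracket α v (ofSeries n p) = coeff 0 p • tableBracket α v (e n 1) := by
  rcases Nat.eq_zero_or_pos n with rfl | hn
  · have h : ofSeries 0 p = 0 := by
      simpa using ofSeries_X_pow_mul 0 p
    simp [h, e_eq_zero]
  refine linearMap_ext_of_X_pow n (f := tableBracket α v ∘ₗ ofSeries n)
    (g := (coeff 0).smulRight (tableBracket α v (e n 1))) ?_ ?_ ?_ p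
  · intro p
    simp [ofSeries_X_pow_mul]
  · intro p
    simp [hn.ne']
  · intro k _
    simp only [LinearMap.comp_apply, LinearMap.smulRight_apply, ofSeries_X_pow, coeff_X_pow]
    rcases Nat.eq_zero_or_pos k with rfl | hk
    · simp
    · rw [bracket_e_ge_two α (by omega), if_neg (by omega), zero_smul]

/-- The difference `θ - α_n`. -/
noncomputable def defect {n : ℕ} (α : Params n) : ℂ := α.theta - α.coeff n

theorem bracket_e0_e0 {n : ℕ} (α : Params n) :
    tableBracket α (e n 0) (e n 0) = ofSeries n X := by
  have := ofSeries_X_pow n 1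
  rw [pow_one] at this
  rw [tableBracket_e α (by omega) (by omega), this]
  simp [table]

theorem bracket_e0_e1_eq {n : ℕ} (hn : 4 ≤ n) (α : Params n) :
    tableBracket α (e n 0) (e n 1) = ofSeries n (gen α + C (defect α) * X ^ (n - 1)) := by
  rw [tableBracket_e α (by omega) (by omega), map_add, ofSeries_C_mul, ofSeries_X_pow,
    ← one_mul (gen α), ← bracket_ofSeries_e1, ofSeries_one, bracket_e1 α (by omega) le_rfl]
  rw [table, if_neg (by omega), if_pos rfl, if_pos rfl, Nat.add_sub_cancel,
    show n - 1 + 1 = n by omega]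
  have h : Finset.Icc 3 n = insert n (Finset.Icc 3 (n - 1)) := by
    ext k
    simp only [Finset.mem_insert, Finset.mem_Icc]
    omega
  rw [h, Finset.sum_insert (by rw [Finset.mem_Icc]; omega), defect, sub_smul]
  have h1 : ∀ k, 1 + k - 1 = k := fun k => by omega
  simp only [h1]
  abel

/-- From the right, `elt n s' q` acts as `s' e_0 + (q(0) - s') e_1`. The `X^{n-1}` term comes from
`e_0 - e_1` on the left. -/
theorem bracket_elt {n : ℕ} (hn : 4 ≤ n) (α : Params n) (s s' : ℂ) (p q : ℂ⟦X⟧) :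
    tableBracket α (elt n s p) (elt n s' q) =
      ofSeries n (p * (C s' * X + C (coeff 0 q - s') * gen α) +
        C (s * (coeff 0 q - s') * defect α) * X ^ (n - 1)) := by
  have h0 : tableBracket α (elt n s p) (e n 0) = ofSeries n (p * X) := by
    rw [elt, map_add, LinearMap.add_apply, map_smul, map_sub, LinearMap.smul_apply,
      LinearMap.sub_apply, bracket_e0_e0, bracket_ofSeries_e0, ← ofSeries_one, bracket_ofSeries_e0,
      one_mul, sub_self, smul_zero, zero_add]
  have h1 : tableBracket α (elt n s p) (e n 1) =
      ofSeries n (p * gen α + C (s * defect α) * X ^ (n - 1)) := by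
    rw [elt, map_add, LinearMap.add_apply, map_smul, map_sub, LinearMap.smul_apply,
      LinearMap.sub_apply, bracket_e0_e1_eq hn]
    have h2 := bracket_ofSeries_e1 α 1
    rw [ofSeries_one] at h2
    rw [h2, one_mul, bracket_ofSeries_e1, ← map_sub, ← map_smul, ← map_add, add_sub_cancel_left,
      smul_eq_C_mul, map_mul]
    congr 1
    ring
  rw [elt.eq_def n s' q, map_add, map_smul, map_sub, bracket_right_ofSeries, h0, h1]
  simp only [smul_sub, ← map_smul, ← map_sub, ← map_add, smul_eq_C_mul]
  congr 1
  simp only [map_mul, map_sub]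
  ring

/-! ### Substitution of `aX + bP` -/

/-- Substitution of a power series without constant term, as a linear map. -/
noncomputable def substLinearMap {u : ℂ⟦X⟧} (hu : X ∣ u) : ℂ⟦X⟧ →ₗ[ℂ] ℂ⟦X⟧ where
  toFun p := p.subst u
  map_add' p q := subst_add (hasSubst_of_X_dvd hu) p q
  map_smul' c p := subst_smul (hasSubst_of_X_dvd hu) c p

theorem subst_X_pow_mul {u : ℂ⟦X⟧} (hu : X ∣ u) (k : ℕ) (p : ℂ⟦X⟧) :
    (X ^ k * p).subst u = u ^ k * p.subst u := by
  rw [subst_mul (hasSubst_of_X_dvd hu), subst_pow (hasSubst_of_X_dvd hu),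
    subst_X (hasSubst_of_X_dvd hu)]

theorem subst_C_mul {u : ℂ⟦X⟧} (hu : X ∣ u) (c : ℂ) (p : ℂ⟦X⟧) :
    (C c * p).subst u = C c * p.subst u := by
  rw [← smul_eq_C_mul, ← smul_eq_C_mul]
  exact subst_smul (hasSubst_of_X_dvd hu) c p

theorem X_pow_dvd_subst {u : ℂ⟦X⟧} (hu : X ∣ u) {k : ℕ} {p : ℂ⟦X⟧} (h : X ^ k ∣ p) :
    X ^ k ∣ p.subst u := by
  obtain ⟨q, rfl⟩ := h
  rw [subst_X_pow_mul hu]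
  exact (pow_dvd_pow_of_dvd hu k).mul_right _

theorem X_pow_dvd_subst_sub {u : ℂ⟦X⟧} (hu : X ∣ u) {k : ℕ} {p q : ℂ⟦X⟧} (h : X ^ k ∣ p - q) :
    X ^ k ∣ p.subst u - q.subst u := by
  rw [← subst_sub (hasSubst_of_X_dvd hu)]
  exact X_pow_dvd_subst hu h

theorem coeff_zero_subst {u : ℂ⟦X⟧} (hu : X ∣ u) (p : ℂ⟦X⟧) :
    coeff 0 (p.subst u) = coeff 0 p := by
  rw [coeff_subst_eq_sum hu]
  simp

theorem linear_eq_X_mul {n : ℕ} (z : Params n) (a b : ℂ) :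
    C a * X + C b * gen z = X * (C a + X * (C b * genShift z)) := by
  rw [gen_eq]
  ring

theorem coeff_self_linear_pow {n : ℕ} (z : Params n) (a b : ℂ) (k : ℕ) :
    coeff k ((C a * X + C b * gen z) ^ k) = a ^ k := by
  rw [linear_eq_X_mul, mul_pow, coeff_X_pow_mul', if_pos le_rfl, Nat.sub_self]
  simp

theorem ofSeries_mul_X_pow_pred {n : ℕ} (hn : 1 ≤ n) (p : ℂ⟦X⟧) :
    ofSeries n (p * X ^ (n - 1)) = ofSeries n (C (coeff 0 p) * X ^ (n - 1)) := by
  refine ofSeries_eq_of_dvd ?_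
  rw [← sub_mul]
  nth_rw 1 [show n = 1 + (n - 1) by omega]
  rw [pow_add, pow_one]
  refine mul_dvd_mul_right ?_ _
  rw [X_dvd_iff]
  simp

theorem ofSeries_mul_linear_pow {n : ℕ} (hn : 1 ≤ n) (z : Params n) (a b : ℂ) (q : ℂ⟦X⟧) :
    ofSeries n (q * (C a * X + C b * gen z) ^ (n - 1)) =
      ofSeries n (C (coeff 0 q * a ^ (n - 1)) * X ^ (n - 1)) := by
  rw [linear_eq_X_mul, mul_pow, mul_comm (X ^ (n - 1)), ← mul_assoc, ofSeries_mul_X_pow_pred hn]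
  simp

theorem coeff_one_mul_linear {n : ℕ} (z : Params n) (a b : ℂ) (q : ℂ⟦X⟧) :
    coeff 1 (q * (C a * X + C b * gen z)) = coeff 0 q * a := by
  rw [linear_eq_X_mul, mul_left_comm, ← zero_add 1, coeff_succ_X_mul]
  simp

/-- Substitution is triangular on coefficients, with diagonal entries `a^k`. -/
theorem eq_zero_of_coeff_subst_eq_zero {n : ℕ} (z : Params n) {a : ℂ} (ha : a ≠ 0) (b : ℂ)
    {p : ℂ⟦X⟧} {N : ℕ} (h : ∀ k < N, coeff k (p.subst (C a * X + C b * gen z)) = 0) :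
    ∀ k < N, coeff k p = 0 := by
  intro k
  induction k using Nat.strong_induction_on with
  | _ k ih =>
    intro hk
    have h1 := h k hk
    rw [coeff_subst_eq_sum (X_dvd_linear z a b), Finset.sum_range_succ, Finset.sum_eq_zero,
      zero_add, coeff_self_linear_pow] at h1
    · exact (mul_eq_zero.1 h1).resolve_right (pow_ne_zero _ ha)
    · intro j hj
      rw [Finset.mem_range] at hj
      rw [ih j hj (by omega), zero_mul]

theorem bracket_ofSeries_elt {n : ℕ} (hn : 4 ≤ n) (α : Params n) (s : ℂ) (p q : ℂ⟦X⟧) :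
    tableBracket α (ofSeries n p) (elt n s q) =
      ofSeries n (p * (C s * X + C (coeff 0 q - s) * gen α)) := by
  rw [← elt_zero, bracket_elt hn]
  simp

/-- The relation between the parameters of two algebras that a base change with leading
coefficients `a`, `b` induces. -/
def BaseChange {n : ℕ} (a b : ℂ) (α α' : Params n) : Prop :=
  (∀ j < n, coeff j ((gen α').subst (C a * X + C b * gen α)) = (a + b) * coeff j (gen α)) ∧
    a ^ (n - 2) * defect α' = defect α

/-! ### An isomorphism induces a base change -/

section Necessity

variable {n : ℕ} {α α' : Params n} {g : (Fin (n + 1) → ℂ) ≃ₗ[ℂ] (Fin (n + 1) → ℂ)}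
  {a c : ℂ} {p q : ℂ⟦X⟧}

theorem hom_ofSeries_X (hn : 4 ≤ n)
    (hg : ∀ x y, g (tableBracket α' x y) = tableBracket α (g x) (g y))
    (h0 : g (e n 0) = elt n a p) (h1 : g (e n 1) = elt n c q) :
    g (ofSeries n X) = ofSeries n (q * (C a * X + C (coeff 0 p - a) * gen α) +
      C (c * (coeff 0 p - a) * defect α) * X ^ (n - 1)) := by
  have h := hg (e n 1) (e n 0)
  rwa [← ofSeries_one, bracket_ofSeries_e0, one_mul, ofSeries_one, h0, h1, bracket_elt hn] at h

/-- Each bracket with `e_0` multiplies the image by `u = aX + bP`. The formula starts at exponent 2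
because the image of `X` carries a term in `X^{n-1}`, which the next factor `u` kills. -/
theorem hom_ofSeries_X_pow (hn : 4 ≤ n)
    (hg : ∀ x y, g (tableBracket α' x y) = tableBracket α (g x) (g y))
    (h0 : g (e n 0) = elt n a p) (h1 : g (e n 1) = elt n c q) (k : ℕ) :
    g (ofSeries n (X ^ (k + 2))) =
      ofSeries n (q * (C a * X + C (coeff 0 p - a) * gen α) ^ (k + 2)) := by
  induction k with
  | zero =>
    have h := hg (ofSeries n X) (e n 0)
    rw [bracket_ofSeries_e0, hom_ofSeries_X hn hg h0 h1, h0, bracket_ofSeries_elt hn] at h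
    rw [zero_add, pow_two, h]
    refine ofSeries_eq_of_dvd ?_
    have h2 : X ^ n ∣ C (c * (coeff 0 p - a) * defect α) * (X ^ (n - 1) *
        (C a * X + C (coeff 0 p - a) * gen α)) := by
      refine Dvd.dvd.mul_left ?_ _
      nth_rw 1 [show n = n - 1 + 1 by omega]
      rw [pow_succ]
      exact mul_dvd_mul_left _ (X_dvd_linear _ _ _)
    convert h2 using 1
    ring
  | succ k ih =>
    have h := hg (ofSeries n (X ^ (k + 2))) (e n 0)
    rwa [bracket_ofSeries_e0, ih, h0, bracket_ofSeries_elt hn, mul_assoc, ← pow_succ,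
      ← pow_succ] at h

theorem hom_ofSeries (hn : 4 ≤ n)
    (hg : ∀ x y, g (tableBracket α' x y) = tableBracket α (g x) (g y))
    (h0 : g (e n 0) = elt n a p) (h1 : g (e n 1) = elt n c q) {r : ℂ⟦X⟧} (hr : X ^ 2 ∣ r) :
    g (ofSeries n r) =
      ofSeries n (q * r.subst (C a * X + C (coeff 0 p - a) * gen α)) := by
  obtain ⟨r, rfl⟩ := hr
  have hu := X_dvd_linear α a (coeff 0 p - a)
  refine linearMap_ext_of_X_pow n
    (f := g.toLinearMap ∘ₗ ofSeries n ∘ₗ LinearMap.mulLeft ℂ (X ^ 2))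
    (g := ofSeries n ∘ₗ LinearMap.mulLeft ℂ q ∘ₗ substLinearMap hu ∘ₗ LinearMap.mulLeft ℂ (X ^ 2))
    ?_ ?_ ?_ r
  · intro s
    simp [mul_left_comm _ (X ^ n), ofSeries_X_pow_mul]
  · intro s
    simp only [LinearMap.comp_apply, LinearMap.mulLeft_apply]
    rw [← map_zero (ofSeries n)]
    refine ofSeries_eq_of_dvd ?_
    rw [sub_zero]
    exact (X_pow_dvd_subst hu ((dvd_mul_right _ _).mul_left _)).mul_left _
  · intro k _
    simp only [LinearMap.comp_apply, LinearMap.mulLeft_apply, LinearEquiv.coe_coe, substLinearMap,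
      LinearMap.coe_mk, AddHom.coe_mk]
    rw [← pow_add, add_comm 2 k, hom_ofSeries_X_pow hn hg h0 h1, subst_pow (hasSubst_of_X_dvd hu),
      subst_X (hasSubst_of_X_dvd hu)]

theorem exists_baseChange_of_hom (hn : 4 ≤ n)
    (hg : ∀ x y, g (tableBracket α' x y) = tableBracket α (g x) (g y)) :
    ∃ a b : ℂ, a ≠ 0 ∧ a + b ≠ 0 ∧ BaseChange a b α α' := by
  obtain ⟨a, p, h0⟩ := exists_elt (g (e n 0))
  obtain ⟨c, q, h1⟩ := exists_elt (g (e n 1))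
  have hu := X_dvd_linear α a (coeff 0 p - a)
  -- The image of `e_n` is nonzero, which forces `q(0) ≠ 0` and `a ≠ 0`.
  have htop : g (ofSeries n (X ^ (n - 1))) =
      ofSeries n (C (coeff 0 q * a ^ (n - 1)) * X ^ (n - 1)) := by
    have h := hom_ofSeries_X_pow hn hg h0 h1 (n - 3)
    rwa [show n - 3 + 2 = n - 1 by omega, ofSeries_mul_linear_pow (by omega)] at h
  have hne : coeff 0 q * a ^ (n - 1) ≠ 0 := by
    intro h
    rw [h, map_zero, zero_mul, map_zero, LinearEquiv.map_eq_zero_iff,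
      ← map_zero (ofSeries n), ofSeries_eq_ofSeries_iff] at htop
    simpa [coeff_X_pow] using htop (n - 1) (by omega)
  have hq : coeff 0 q ≠ 0 := left_ne_zero_of_mul hne
  have ha : a ≠ 0 := by
    rintro rfl
    rw [zero_pow (by omega), mul_zero] at hne
    exact hne rfl
  -- In the source, `[e_0, e_0] = [e_1, e_0] = e_2`.
  have h00 : ofSeries n (p * (C a * X + C (coeff 0 p - a) * gen α) +
      C (a * (coeff 0 p - a) * defect α) * X ^ (n - 1)) =
      ofSeries n (q * (C a * X + C (coeff 0 p - a) * gen α) +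
      C (c * (coeff 0 p - a) * defect α) * X ^ (n - 1)) := by
    have h := hg (e n 0) (e n 0)
    rwa [bracket_e0_e0, hom_ofSeries_X hn hg h0 h1, h0, bracket_elt hn, eq_comm] at h
  have hpq : coeff 0 p = coeff 0 q := by
    have h := ofSeries_eq_ofSeries_iff.1 h00 1 (by omega)
    rw [map_add, map_add, coeff_one_mul_linear, coeff_one_mul_linear, coeff_C_mul, coeff_C_mul,
      coeff_X_pow, if_neg (by omega), mul_zero, mul_zero, add_zero, add_zero] at h
    exact mul_right_cancel₀ ha h
  have hgen : X ^ 2 ∣ gen α' := by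
    rw [gen_eq]
    exact dvd_mul_right _ _
  have h11 : ofSeries n (q * (gen α').subst (C a * X + C (coeff 0 p - a) * gen α)) =
      ofSeries n (q * (C c * X + C (coeff 0 q - c) * gen α) +
        C (c * (coeff 0 q - c) * defect α) * X ^ (n - 1)) := by
    have h := hg (e n 1) (e n 1)
    have h2 := bracket_ofSeries_e1 α' 1
    rw [ofSeries_one, one_mul] at h2
    rwa [h1, bracket_elt hn, h2,
      hom_ofSeries hn hg h0 h1 hgen] at h
  -- `[e_1, e_1]` has no component along `X`, and neither has its image, whereas the bracket of the
  -- images has `q(0) c` there.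
  have hc : c = 0 := by
    have h := ofSeries_eq_ofSeries_iff.1 h11 1 (by omega)
    rw [map_add, coeff_one_mul_linear, coeff_C_mul, coeff_X_pow, if_neg (by omega), mul_zero,
      add_zero, X_pow_dvd_iff.1 ((X_pow_dvd_subst hu hgen).mul_left q) 1 (by omega)] at h
    exact (mul_eq_zero.1 h.symm).resolve_left hq
  subst hc
  have hqu : IsUnit q := by
    rw [isUnit_iff_constantCoeff, isUnit_iff_ne_zero]
    simpa using hq
  have hcomp : X ^ n ∣ (gen α').subst (C a * X + C (coeff 0 p - a) * gen α) -
      C (coeff 0 q) * gen α := by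
    rw [ofSeries_eq_iff_dvd] at h11
    rw [← hqu.dvd_mul_left]
    convert h11 using 1
    simp only [sub_zero, map_zero, zero_mul]
    ring
  refine ⟨a, coeff 0 p - a, ha, ?_, ?_, ?_⟩
  · rwa [add_sub_cancel, hpq]
  · intro j hj
    have h := X_pow_dvd_iff.1 hcomp j hj
    rw [map_sub, coeff_C_mul, sub_eq_zero] at h
    rw [h, hpq, add_sub_cancel]
  · have h01 : ofSeries n (q * (gen α').subst (C a * X + C (coeff 0 p - a) * gen α) +
        C (defect α' * (coeff 0 q * a ^ (n - 1))) * X ^ (n - 1)) =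
        ofSeries n (p * (C (coeff 0 q) * gen α) +
          C (a * coeff 0 q * defect α) * X ^ (n - 1)) := by
      have h := hg (e n 0) (e n 1)
      rw [bracket_e0_e1_eq hn, h0, h1, bracket_elt hn, map_add, map_add, ofSeries_C_mul, map_smul,
        htop, hom_ofSeries hn hg h0 h1 hgen, ← ofSeries_C_mul, ← map_add, ← mul_assoc,
        ← map_mul] at h
      rw [h]
      simp
    -- Modulo `X^{n-1}`, `h00` says `(p - q) u ≡ 0`. As `u` is `X` times a unit, `X^{n-2}` divides
    -- `p - q`, and `gen α` supplies the remaining `X^2`.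
    have hdvd : X ^ n ∣ (p - q) * gen α := by
      rw [ofSeries_eq_iff_dvd] at h00
      have h2 : X ^ (n - 1) ∣ (p - q) * (C a * X + C (coeff 0 p - a) * gen α) := by
        have h3 := (pow_dvd_pow (X : ℂ⟦X⟧) (show n - 1 ≤ n by omega)).trans h00
        have h4 : X ^ (n - 1) ∣ C (a * (coeff 0 p - a) * defect α) * X ^ (n - 1) :=
          dvd_mul_left _ _
        have h5 := dvd_sub h3 h4
        convert h5 using 1
        simp only [zero_mul, map_zero]
        ring
      have hv : IsUnit (C a + X * (C (coeff 0 p - a) * genShift α)) := by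
        rw [isUnit_iff_constantCoeff, isUnit_iff_ne_zero]
        simpa using ha
      rw [linear_eq_X_mul, mul_left_comm, show n - 1 = n - 2 + 1 by omega, pow_succ',
        mul_dvd_mul_iff_left X_ne_zero, hv.dvd_mul_right] at h2
      rw [gen_eq]
      nth_rw 1 [show n = n - 2 + 2 by omega]
      rw [pow_add]
      exact mul_dvd_mul h2 (dvd_mul_right _ _)
    have hdiff := ofSeries_eq_iff_dvd.1 h01
    have h6 := X_pow_dvd_iff.1 (dvd_add (dvd_sub hdiff (hcomp.mul_left q))
      (hdvd.mul_left (C (coeff 0 q)))) (n - 1) (by omega)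
    -- All other terms cancel, so only a multiple of `X^{n-1}` is left; divisibility by `X^n` makes
    -- its coefficient vanish.
    have h7 : q * (gen α').subst (C a * X + C (coeff 0 p - a) * gen α) +
        C (defect α' * (coeff 0 q * a ^ (n - 1))) * X ^ (n - 1) -
        (p * (C (coeff 0 q) * gen α) + C (a * coeff 0 q * defect α) * X ^ (n - 1)) -
        q * ((gen α').subst (C a * X + C (coeff 0 p - a) * gen α) - C (coeff 0 q) * gen α) +
        C (coeff 0 q) * ((p - q) * gen α) =
        C (defect α' * (coeff 0 q * a ^ (n - 1)) - a * coeff 0 q * defect α) * X ^ (n - 1) := by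
      simp only [map_sub]
      ring
    rw [h7, coeff_C_mul, coeff_X_pow, if_pos rfl, mul_one, show n - 1 = n - 2 + 1 by omega,
      pow_succ] at h6
    apply mul_left_cancel₀ (mul_ne_zero ha hq)
    linear_combination h6

end Necessity

/-! ### A base change gives an isomorphism -/

section Sufficiency

variable {n : ℕ}

/-- The linear map that realises a base change:
`s (e_0 - e_1) + p ↦ s a (e_0 - e_1) - s b δ X^{n-2} + (a + b) p(a X + b P)`. -/
noncomputable def baseChangeMap (a b : ℂ) (α : Params n) :
    (Fin (n + 1) → ℂ) →ₗ[ℂ] (Fin (n + 1) → ℂ) :=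
  (LinearMap.proj 0).smulRight (elt n a (C (-(b * defect α)) * X ^ (n - 2))) +
    ofSeries n ∘ₗ LinearMap.mulLeft ℂ (C (a + b)) ∘ₗ substLinearMap (X_dvd_linear α a b) ∘ₗ
      (toSeries n + (LinearMap.proj 0).smulRight (1 : ℂ⟦X⟧))

theorem smul_elt (c s : ℂ) (p : ℂ⟦X⟧) : c • elt n s p = elt n (c * s) (C c * p) := by
  rw [elt, elt, smul_add, smul_smul, ofSeries_C_mul]

theorem elt_add_ofSeries (s : ℂ) (p q : ℂ⟦X⟧) : elt n s p + ofSeries n q = elt n s (p + q) := by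
  rw [elt, elt, map_add, add_assoc]

theorem elt_apply_zero (s : ℂ) (p : ℂ⟦X⟧) : elt n s p 0 = s := by
  simp [elt, e, ofSeries]

theorem X_pow_dvd_toSeries_elt (s : ℂ) (p : ℂ⟦X⟧) :
    X ^ n ∣ toSeries n (elt n s p) + s • (1 : ℂ⟦X⟧) - p := by
  rw [X_pow_dvd_iff]
  intro k hk
  rcases Nat.eq_zero_or_pos k with rfl | h
  · simp [toSeries, elt, e, ofSeries, hk]
  · simp [toSeries, elt, e, ofSeries, hk, coeff_one, h.ne']

theorem baseChangeMap_elt (a b : ℂ) (α : Params n) (s : ℂ) (p : ℂ⟦X⟧) :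
    baseChangeMap a b α (elt n s p) =
      elt n (s * a) (C (-(s * b * defect α)) * X ^ (n - 2) +
        C (a + b) * p.subst (C a * X + C b * gen α)) := by
  have h : ofSeries n (C (a + b) * (toSeries n (elt n s p) + s • (1 : ℂ⟦X⟧)).subst
      (C a * X + C b * gen α)) = ofSeries n (C (a + b) * p.subst (C a * X + C b * gen α)) := by
    rw [ofSeries_C_mul, ofSeries_C_mul]
    congr 1
    exact ofSeries_eq_of_dvd
      (X_pow_dvd_subst_sub (X_dvd_linear α a b) (X_pow_dvd_toSeries_elt s p))
  simp only [baseChangeMap, LinearMap.add_apply, LinearMap.comp_apply, LinearMap.smulRight_apply,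
    LinearMap.proj_apply, LinearMap.mulLeft_apply, substLinearMap, LinearMap.coe_mk,
    AddHom.coe_mk, elt_apply_zero]
  rw [h, smul_elt, elt_add_ofSeries, ← mul_assoc, ← map_mul]
  congr 4
  ring

theorem baseChangeMap_injective {a b : ℂ} (ha : a ≠ 0) (hab : a + b ≠ 0) (α : Params n) :
    Function.Injective (baseChangeMap a b α) := by
  rw [← LinearMap.ker_eq_bot, LinearMap.ker_eq_bot']
  intro v hv
  obtain ⟨s, p, rfl⟩ := exists_elt v
  have h0 : (0 : Fin (n + 1) → ℂ) = elt n 0 0 := by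
    rw [elt_zero, map_zero]
  rw [baseChangeMap_elt, h0, elt_inj] at hv
  obtain ⟨hs, hp⟩ := hv
  have hs0 : s = 0 := (mul_eq_zero.1 hs).resolve_right ha
  subst hs0
  rw [h0, elt_inj]
  refine ⟨rfl, ?_⟩
  simp only [zero_mul, neg_zero, map_zero, zero_add, coeff_C_mul, mul_eq_zero, hab,
    false_or] at hp
  simpa using eq_zero_of_coeff_subst_eq_zero α ha b hp

/-- The term `-s b δ X^{n-2}` of the map contributes `-s s' a b δ X^{n-1}` to the bracket of the
images. This turns `s a δ ((a + b) q(0) - s' a)` into `s a δ (a + b)(q(0) - s')`, as `a^{n-1} δ' = a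
δ` requires. -/
theorem baseChangeMap_bracket (hn : 4 ≤ n) {a b : ℂ} {α α' : Params n}
    (h : BaseChange a b α α') (x y : Fin (n + 1) → ℂ) :
    baseChangeMap a b α (tableBracket α' x y) =
      tableBracket α (baseChangeMap a b α x) (baseChangeMap a b α y) := by
  obtain ⟨s, p, rfl⟩ := exists_elt x
  obtain ⟨s', q, rfl⟩ := exists_elt y
  obtain ⟨h1, h2⟩ := h
  have hu := X_dvd_linear α a b
  set u := C a * X + C b * gen α with hu_def
  have hq : coeff 0 (C (-(s' * b * defect α)) * X ^ (n - 2) + C (a + b) * q.subst u) =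
      (a + b) * coeff 0 q := by
    rw [map_add, coeff_C_mul, coeff_C_mul, coeff_zero_subst hu, coeff_X_pow, if_neg (by omega)]
    ring
  obtain ⟨w, hw⟩ : X ^ n ∣ (gen α').subst u - C (a + b) * gen α := by
    rw [X_pow_dvd_iff]
    intro j hj
    rw [map_sub, h1 j hj, coeff_C_mul, sub_self]
  have hw' := eq_add_of_sub_eq' hw
  rw [bracket_elt hn, ← elt_zero, baseChangeMap_elt, baseChangeMap_elt, baseChangeMap_elt,
    bracket_elt hn, hq, zero_mul, elt_zero, ofSeries_eq_iff_dvd, ← hu_def]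
  have hsub : (p * (C s' * X + C (coeff 0 q - s') * gen α') +
      C (s * (coeff 0 q - s') * defect α') * X ^ (n - 1)).subst u =
      p.subst u * (C s' * u + C (coeff 0 q - s') * (gen α').subst u) +
        C (s * (coeff 0 q - s') * defect α') * u ^ (n - 1) := by
    have hs := hasSubst_of_X_dvd hu
    have hX : (X : ℂ⟦X⟧).subst u = u := subst_X hs
    have hX' : (X ^ (n - 1) : ℂ⟦X⟧).subst u = u ^ (n - 1) := by rw [subst_pow hs, hX]
    rw [subst_add hs, subst_mul hs, subst_add hs, subst_C_mul hu, subst_C_mul hu, subst_C_mul hu,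
      hX, hX']
  rw [hsub, hw']
  obtain ⟨v, hv⟩ : X ^ n ∣ u ^ (n - 1) - C (a ^ (n - 1)) * X ^ (n - 1) := by
    rw [← ofSeries_eq_iff_dvd]
    have := ofSeries_mul_linear_pow (n := n) (by omega) α a b 1
    simpa using this
  have hv' := eq_add_of_sub_eq' hv
  rw [hv', gen_eq, ← h2]
  obtain ⟨m, rfl⟩ := Nat.exists_eq_add_of_le' hn
  simp only [show m + 4 - 1 = m + 3 by omega, show m + 4 - 2 = m + 2 by omega]
  have hua : u = C a * X + C b * (X ^ 2 * genShift α) := by rw [hu_def, gen_eq]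
  -- The cofactor of `X^n` collects the error `w` in `P'(u)`, the error `v` in `u^{n-1}`, and the
  -- product of the `X^{n-2}` correction with `P = X^2 Q`.
  refine ⟨C (a + b) * (p.subst u * (C (coeff 0 q - s') * w)) +
    C ((a + b) * (s * (coeff 0 q - s') * defect α')) * v +
    C (s * b * (a ^ (m + 2) * defect α') * ((a + b) * coeff 0 q - s' * a)) * genShift α, ?_⟩
  generalize p.subst u = p'
  rw [hua]
  simp only [map_mul, map_sub, map_add, map_neg, map_pow, map_zero, zero_mul, neg_zero]
  ring

end Sufficiency

/-! ### The isomorphism criterion in terms of `ρ` -/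

theorem isomorphic_iff {n : ℕ} (hn : 4 ≤ n) (α α' : Params n) :
    (L α').Isomorphic (L α) ↔ ∃ a b : ℂ, a ≠ 0 ∧ a + b ≠ 0 ∧ BaseChange a b α α' := by
  constructor
  · rintro ⟨g, hg⟩
    exact exists_baseChange_of_hom hn hg
  · rintro ⟨a, b, ha, hab, h⟩
    exact ⟨LinearEquiv.ofInjectiveEndo _ (baseChangeMap_injective ha hab α),
      baseChangeMap_bracket hn h⟩

theorem isomorphic_iff_rho {n : ℕ} (hn : 4 ≤ n) (α α' : Params n) :
    (L α').Isomorphic (L α) ↔ ∃ x y : ℂ, x ≠ 0 ∧ 1 + y ≠ 0 ∧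
      ∀ i ∈ Finset.Icc 1 (n - 1), rho x y α i = α'.coeff (i + 2) := by
  rw [isomorphic_iff hn]
  constructor
  · rintro ⟨a, b, ha, hab, h⟩
    refine ⟨a⁻¹, b / a, inv_ne_zero ha, ?_, (rho_iff hn α α' ha).1 h⟩
    rw [one_add_div ha]
    exact div_ne_zero hab ha
  · rintro ⟨x, y, hx, hy, h⟩
    refine ⟨x⁻¹, y * x⁻¹, inv_ne_zero hx, ?_, (rho_iff hn α α' (inv_ne_zero hx)).2 ?_⟩
    · rw [← one_add_mul]
      exact mul_ne_zero hy (inv_ne_zero hx)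
    · rwa [inv_inv, mul_div_cancel_right₀ _ (inv_ne_zero hx)]

theorem LeibnizAlgebra.Isomorphic.symm {K V W : Type*} [CommRing K] [AddCommGroup V] [Module K V]
    [AddCommGroup W] [Module K W] {A : LeibnizAlgebra K V} {B : LeibnizAlgebra K W}
    (h : A.Isomorphic B) : B.Isomorphic A := by
  obtain ⟨f, hf⟩ := h
  exact ⟨f.symm, fun x y => by rw [LinearEquiv.symm_apply_eq, hf]; simp⟩

theorem LeibnizAlgebra.Isomorphic.trans {K V W U : Type*} [CommRing K] [AddCommGroup V]
    [Module K V] [AddCommGroup W] [Module K W] [AddCommGroup U] [Module K U]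
    {A : LeibnizAlgebra K V} {B : LeibnizAlgebra K W} {D : LeibnizAlgebra K U}
    (h : A.Isomorphic B) (h' : B.Isomorphic D) : A.Isomorphic D := by
  obtain ⟨f, hf⟩ := h
  obtain ⟨g, hg⟩ := h'
  exact ⟨f.trans g, fun x y => by simp [hf, hg]⟩

/-! ### The normal form `α₃ = 1`, `α₄ = 0` -/

theorem factor_zero {n : ℕ} (z : Params n) (k t : ℕ) : factor 0 z k t = 0 := by
  rw [factor]
  refine Finset.sum_eq_zero fun m hm => ?_
  rw [Finset.mem_Icc] at hm
  rw [zero_pow (by omega)]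
  ring

theorem rho_one_zero {n : ℕ} (z : Params n) {i : ℕ} (hi : i ∈ Finset.Icc 1 (n - 1)) :
    rho 1 0 z i = z.coeff (i + 2) := by
  rw [Finset.mem_Icc] at hi
  rw [rho]
  split_ifs with h
  · simp only [phiLast, factor_zero]
    rw [h, show n - 1 + 2 = n + 1 by omega, Params.theta]
    simp
  · rw [phi_eq]
    simp [factor_zero]

/-- The parameters with entries `ρ_{t-2}(x, y; z)`. -/
noncomputable def transform {n : ℕ} (x y : ℂ) (z : Params n) : Params n :=
  fun t => rho x y z ((t : ℕ) - 2)

theorem coeff_transform {n : ℕ} (x y : ℂ) (z : Params n) {i : ℕ} (hi : i ∈ Finset.Icc 1 (n - 1)) :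
    (transform x y z).coeff (i + 2) = rho x y z i := by
  rw [Finset.mem_Icc] at hi
  rw [Params.coeff, dif_pos (Finset.mem_Icc.2 (by omega)), transform]
  simp

theorem rho_one_eq {n : ℕ} (hn : 4 ≤ n) (x y : ℂ) (z : Params n) :
    rho x y z 1 = x * ((1 + y) * z.coeff 3) := by
  rw [rho, if_neg (by omega), phi_eq]
  simp

/-- Source of the arguments in the theorem: the last factor vanishes for `y = z_4 / (2 z_3^2)`, and
then `ρ_1 = x (1 + y) z_3 = 1` determines `x`. -/
theorem rho_two_eq {n : ℕ} (hn : 4 ≤ n) (x y : ℂ) (z : Params n) :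
    rho x y z 2 = x ^ 2 * ((1 + y) * (z.coeff 4 - 2 * y * z.coeff 3 ^ 2)) := by
  have h : factor y z 3 4 = 2 * y * z.coeff 3 := by
    simp [factor, Finset.sum_Icc_succ_top, nested]
  rw [rho, if_neg (by omega), phi_eq]
  simp only [Nat.reduceAdd, Nat.add_one_sub_one, Finset.Icc_self, Finset.sum_singleton, h]
  rw [phi_eq, Finset.Icc_eq_empty (by omega), Finset.sum_empty]
  ring

/-- The parameters of the representative with `α₃ = 1` and `α₄ = 0`. -/
noncomputable def normalForm {n : ℕ} (α : Params n) : Params n :=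
  transform (2 * α.coeff 3 / (α.coeff 4 + 2 * α.coeff 3 ^ 2)) (α.coeff 4 / (2 * α.coeff 3 ^ 2)) α

section NormalForm

variable {n : ℕ} {α : Params n}

theorem normalForm_coeff_three (hn : 4 ≤ n) (hα : α ∈ genericSet n) :
    (normalForm α).coeff 3 = 1 := by
  have h3 : α.coeff 3 ≠ 0 := left_ne_zero_of_mul hα
  have h4 : α.coeff 4 + 2 * α.coeff 3 ^ 2 ≠ 0 := right_ne_zero_of_mul hα
  rw [normalForm, coeff_transform _ _ _ (i := 1) (Finset.mem_Icc.2 (by omega)), rho_one_eq hn]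
  field_simp
  ring

theorem normalForm_coeff_four (hn : 4 ≤ n) (hα : α ∈ genericSet n) :
    (normalForm α).coeff 4 = 0 := by
  have h3 : α.coeff 3 ≠ 0 := left_ne_zero_of_mul hα
  rw [normalForm, coeff_transform _ _ _ (i := 2) (Finset.mem_Icc.2 (by omega)), rho_two_eq hn]
  have : α.coeff 4 - 2 * (α.coeff 4 / (2 * α.coeff 3 ^ 2)) * α.coeff 3 ^ 2 = 0 := by
    field_simp
    ring
  rw [this, mul_zero, mul_zero]

theorem normalForm_isomorphic (hn : 4 ≤ n) (hα : α ∈ genericSet n) :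
    (L (normalForm α)).Isomorphic (L α) := by
  have h3 : α.coeff 3 ≠ 0 := left_ne_zero_of_mul hα
  have h4 : α.coeff 4 + 2 * α.coeff 3 ^ 2 ≠ 0 := right_ne_zero_of_mul hα
  rw [isomorphic_iff_rho hn]
  refine ⟨_, _, div_ne_zero (mul_ne_zero two_ne_zero h3) h4, ?_,
    fun i hi => (coeff_transform _ _ α hi).symm⟩
  have h : (1 : ℂ) + α.coeff 4 / (2 * α.coeff 3 ^ 2) =
      (α.coeff 4 + 2 * α.coeff 3 ^ 2) / (2 * α.coeff 3 ^ 2) := by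
    field_simp
    ring
  rw [h]
  exact div_ne_zero h4 (mul_ne_zero two_ne_zero (pow_ne_zero _ h3))

end NormalForm

/-- The first two equations read `x(1 + y) = 1` and `-2 x^2 (1 + y) y = 0`. They force `y = 0` and
`x = 1`, where `ρ` is the identity. -/
theorem coeff_eq_of_isomorphic {n : ℕ} (hn : 4 ≤ n) {α α' : Params n} (h3 : α.coeff 3 = 1)
    (h4 : α.coeff 4 = 0) (h3' : α'.coeff 3 = 1) (h4' : α'.coeff 4 = 0)
    (h : (L α').Isomorphic (L α)) {i : ℕ} (hi : i ∈ Finset.Icc 1 (n - 1)) :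
    α.coeff (i + 2) = α'.coeff (i + 2) := by
  obtain ⟨x, y, hx, hy, hρ⟩ := (isomorphic_iff_rho hn α α').1 h
  have h1 := hρ 1 (Finset.mem_Icc.2 (by omega))
  have h2 := hρ 2 (Finset.mem_Icc.2 (by omega))
  rw [rho_one_eq hn, h3, h3', mul_one] at h1
  rw [rho_two_eq hn, h3, h4, h4'] at h2
  have hy0 : y = 0 := by simpa [hx, hy] using h2
  subst hy0
  have hx1 : x = 1 := by simpa using h1
  subst hx1
  rw [← rho_one_zero α hi, hρ i hi]

theorem params_ext {n : ℕ} {α α' : Params n}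
    (h : ∀ i ∈ Finset.Icc 1 (n - 1), α.coeff (i + 2) = α'.coeff (i + 2)) : α = α' := by
  funext ⟨t, ht⟩
  have ht' := Finset.mem_Icc.1 ht
  have h1 := h (t - 2) (Finset.mem_Icc.2 (by omega))
  rw [show t - 2 + 2 = t by omega, Params.coeff, Params.coeff, dif_pos ht, dif_pos ht] at h1
  exact h1

theorem isomorphic_iff_normalForm_eq {n : ℕ} (hn : 4 ≤ n) {α α' : Params n}
    (hα : α ∈ genericSet n) (hα' : α' ∈ genericSet n) :
    (L α).Isomorphic (L α') ↔ normalForm α = normalForm α' := by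
  constructor
  · intro h
    refine (params_ext fun i hi => coeff_eq_of_isomorphic hn (normalForm_coeff_three hn hα')
      (normalForm_coeff_four hn hα') (normalForm_coeff_three hn hα) (normalForm_coeff_four hn hα)
      ?_ hi).symm
    exact ((normalForm_isomorphic hn hα).trans h).trans (normalForm_isomorphic hn hα').symm
  · intro h
    have h1 := (normalForm_isomorphic hn hα).symm
    rw [h] at h1
    exact h1.trans (normalForm_isomorphic hn hα')

end FiliformLeibniz

/-! ### Complete invariants and their independence -/

theorem theorem3 (n : ℕ) (hn : 4 ≤ n) :
    (∀ α α' : FiliformLeibniz.Params n,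
      α ∈ FiliformLeibniz.genericSet n → α' ∈ FiliformLeibniz.genericSet n →
      ((FiliformLeibniz.L α).Isomorphic (FiliformLeibniz.L α') ↔
        ∀ i ∈ Finset.Icc 3 (n - 1),
          FiliformLeibniz.rho (2 * α.coeff 3 / (α.coeff 4 + 2 * α.coeff 3 ^ 2))
              (α.coeff 4 / (2 * α.coeff 3 ^ 2)) α i =
            FiliformLeibniz.rho (2 * α'.coeff 3 / (α'.coeff 4 + 2 * α'.coeff 3 ^ 2))
              (α'.coeff 4 / (2 * α'.coeff 3 ^ 2)) α' i)) ∧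
    (∀ a : ↥(Finset.Icc 3 (n - 1)) → ℂ, ∃ α ∈ FiliformLeibniz.genericSet n,
      ∀ i : ↥(Finset.Icc 3 (n - 1)),
        FiliformLeibniz.rho (2 * α.coeff 3 / (α.coeff 4 + 2 * α.coeff 3 ^ 2))
          (α.coeff 4 / (2 * α.coeff 3 ^ 2)) α i = a i) := by
  open FiliformLeibniz in
  refine ⟨fun α α' hα hα' => ?_, fun a => ?_⟩
  · rw [isomorphic_iff_normalForm_eq hn hα hα']
    constructor
    · intro h i hi
      have hi' : i ∈ Finset.Icc 1 (n - 1) := Finset.Icc_subset_Icc (by omega) le_rfl hi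
      rw [← coeff_transform _ _ α hi', ← coeff_transform _ _ α' hi']
      exact congrArg (fun z : Params n => z.coeff (i + 2)) h
    · intro h
      refine params_ext fun i hi => ?_
      by_cases h1 : i = 1
      · subst h1
        rw [normalForm_coeff_three hn hα, normalForm_coeff_three hn hα']
      by_cases h2 : i = 2
      · subst h2
        rw [normalForm_coeff_four hn hα, normalForm_coeff_four hn hα']
      rw [normalForm, normalForm, coeff_transform _ _ _ hi, coeff_transform _ _ _ hi]
      rw [Finset.mem_Icc] at hi
      exact h i (Finset.mem_Icc.2 (by omega))
  -- A parameter already in normal form, so `x = 1` and `y = 0`. The entry at `t = 4` takes the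
  -- default value 0, since `4 - 2` lies below the range of `a`.
  · let α : Params n := fun t =>
      if (t : ℕ) = 3 then 1 else
        if h : (t : ℕ) - 2 ∈ Finset.Icc 3 (n - 1) then a ⟨(t : ℕ) - 2, h⟩ else 0
    have h3 : α.coeff 3 = 1 := by
      rw [Params.coeff, dif_pos (Finset.mem_Icc.2 (by omega))]
      exact if_pos rfl
    have h4 : α.coeff 4 = 0 := by
      rw [Params.coeff, dif_pos (Finset.mem_Icc.2 (by omega))]
      simp [α]
    refine ⟨α, ?_, fun i => ?_⟩
    · simp [genericSet, h3, h4]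
    · obtain ⟨i, hi⟩ := i
      have hi' := Finset.mem_Icc.1 hi
      dsimp only
      have hx : 2 * α.coeff 3 / (α.coeff 4 + 2 * α.coeff 3 ^ 2) = 1 := by
        rw [h3, h4]
        norm_num
      have hy : α.coeff 4 / (2 * α.coeff 3 ^ 2) = 0 := by rw [h4, zero_div]
      rw [hx, hy, rho_one_zero α (Finset.mem_Icc.2 (by omega)), Params.coeff,
        dif_pos (Finset.mem_Icc.2 (by omega))]
      have h5 : i + 2 ≠ 3 := by omega
      simp only [α, if_neg h5, Nat.add_sub_cancel, dif_pos hi]
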